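/- **Ilmanen's Insertion Lemma.** A *modulus* is a continuous non-decreasing concave function $\omega:[0,+\infty[\to[0,+\infty[$ with $\omega(0)=0$; it is *linear* if $\omega(t)=kt$ for some $k\ge 0$. Let $O\subset\mathbb{R}^n$ be open, with $\mathbb{R}^n$ carrying its Euclidean norm. A function $u:O\to\mathbb{R}$ is *semi-concave on $O$ with modulus $\omega$* if there is a constant $C<+\infty$ such that for every $x\in O$ there is a linear map $\ell_x:\mathbb{R}^n\to\mathbb{R}$ with $$u(y)-u(x)\le \ell_x(y-x)+C\|y-x\|\,\omega(\|y-x\|)\qquad\text{for all }y\in O;$$ it is *locally semi-concave with modulus $\omega$* if every point of $O$ has an open neighborhood $V\subset O$ such that $u|_V$ is semi-concave on $V$ with modulus $\omega$. It is (locally) *semi-convex with modulus $\omega$* if $-u$ is (locally) semi-concave with modulus $\omega$. The function $u$ is $C^{1,1}$ on $O$ if it is differentiable at every point of $O$ and its derivative is locally Lipschitz on $O$. Let $M$ be a (Hausdorff, paracompact) $C^2$ manifold of dimension $n$ without boundary. A function $u:M\to\mathbb{R}$ is *locally semi-concave* (resp. *locally semi-convex*) *for a linear modulus* if there is a linear modulus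 $\omega$ such that every point of $M$ lies in the domain of a chart $\varphi$ of the maximal $C^2$ atlas for which $u\circ\varphi^{-1}$ is locally semi-concave (resp. locally semi-convex) with modulus $\omega$ on the image of $\varphi$. It is $C^{1,1}$ if $u\circ\varphi^{-1}$ is $C^{1,1}$ on the image of $\varphi$ for every chart $\varphi$ of the maximal $C^2$ atlas. **Theorem.** Let $M$ be a $C^2$ manifold, let $f:M\to\mathbb{R}$ be locally semi-convex for a linear modulus and let $g:M\to\mathbb{R}$ be locally semi-concave for a linear modulus. If $f\le g$ on $M$, then there is a $C^{1,1}$ function $h:M\to\mathbb{R}$ such that $f\le h\le g$ on $M$. -/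

import Mathlib

open scoped Manifold

/-- `ω` is read on `[0, +∞[` only: it is continuous, non-decreasing, concave, nonnegative and
vanishes at `0` there. -/
structure IsModulus (ω : ℝ → ℝ) : Prop where
  continuousOn : ContinuousOn ω (Set.Ici 0)
  monotoneOn : MonotoneOn ω (Set.Ici 0)
  concaveOn : ConcaveOn ℝ (Set.Ici 0) ω
  nonneg : ∀ t, 0 ≤ t → 0 ≤ ω t
  map_zero : ω 0 = 0

/-- A linear modulus is a modulus of the form `t ↦ k t` on `[0, +∞[`, with `k ≥ 0`. -/
def IsLinearModulus (ω : ℝ → ℝ) : Prop :=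
  IsModulus ω ∧ ∃ k : ℝ, 0 ≤ k ∧ ∀ t, 0 ≤ t → ω t = k * t

section Euclidean

variable {E : Type*} [NormedAddCommGroup E] [NormedSpace ℝ E]

/-- `f` is semi-concave on `O` with modulus `ω`. -/
def SemiconcaveOn (ω : ℝ → ℝ) (O : Set E) (f : E → ℝ) : Prop :=
  ∃ C : ℝ, ∀ x ∈ O, ∃ l : E →ₗ[ℝ] ℝ, ∀ y ∈ O,
    f y - f x ≤ l (y - x) + C * ‖y - x‖ * ω ‖y - x‖

/-- `f` is semi-convex on `O` with modulus `ω`. -/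
def SemiconvexOn (ω : ℝ → ℝ) (O : Set E) (f : E → ℝ) : Prop :=
  SemiconcaveOn ω O (fun x => -f x)

/-- `f` is locally semi-concave on the open set `O` with modulus `ω`. -/
def LocallySemiconcaveOn (ω : ℝ → ℝ) (O : Set E) (f : E → ℝ) : Prop :=
  ∀ x ∈ O, ∃ V : Set E, IsOpen V ∧ x ∈ V ∧ V ⊆ O ∧ SemiconcaveOn ω V f

/-- `f` is locally semi-convex on the open set `O` with modulus `ω`. -/
def LocallySemiconvexOn (ω : ℝ → ℝ) (O : Set E) (f : E → ℝ) : Prop :=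
  ∀ x ∈ O, ∃ V : Set E, IsOpen V ∧ x ∈ V ∧ V ⊆ O ∧ SemiconvexOn ω V f

/-- `f` is `C^{1,ω}` on the open set `O`: it is differentiable at every point of `O`, and its
derivative has, locally in `O`, modulus of continuity `K ω`. -/
def IsC1ModulusOn (ω : ℝ → ℝ) (O : Set E) (f : E → ℝ) : Prop :=
  (∀ x ∈ O, DifferentiableAt ℝ f x) ∧
    ∀ x ∈ O, ∃ V : Set E, IsOpen V ∧ x ∈ V ∧ V ⊆ O ∧ ∃ K : ℝ, ∀ y ∈ V, ∀ z ∈ V,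
      ‖fderiv ℝ f y - fderiv ℝ f z‖ ≤ K * ω ‖y - z‖

/-- `f` is `C^{1,1}` on the open set `O`: differentiable with locally Lipschitz derivative. -/
def IsC11On (O : Set E) (f : E → ℝ) : Prop :=
  IsC1ModulusOn (fun t => t) O f

end Euclidean

section Manifold

variable (n : ℕ) {M : Type*} [TopologicalSpace M] [ChartedSpace (EuclideanSpace ℝ (Fin n)) M]

/-- `f : M → ℝ` is locally semi-concave for a linear modulus on the `C^2` manifold `M`: around every
point there is a chart of the maximal `C^2` atlas in which `f` is locally semi-concave for a linear
modulus. -/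
def MLocallySemiconcaveLinear (f : M → ℝ) : Prop :=
  ∃ ω : ℝ → ℝ, IsLinearModulus ω ∧ ∀ x : M,
    ∃ e ∈ IsManifold.maximalAtlas 𝓘(ℝ, EuclideanSpace ℝ (Fin n)) 2 M, x ∈ e.source ∧
      LocallySemiconcaveOn ω e.target (fun y => f (e.symm y))

/-- `f : M → ℝ` is locally semi-convex for a linear modulus on the `C^2` manifold `M`: around every
point there is a chart of the maximal `C^2` atlas in which `f` is locally semi-convex for a linear
modulus. -/
def MLocallySemiconvexLinear (f : M → ℝ) : Prop :=
  ∃ ω : ℝ → ℝ, IsLinearModulus ω ∧ ∀ x : M,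
    ∃ e ∈ IsManifold.maximalAtlas 𝓘(ℝ, EuclideanSpace ℝ (Fin n)) 2 M, x ∈ e.source ∧
      LocallySemiconvexOn ω e.target (fun y => f (e.symm y))

/-- `h : M → ℝ` is `C^{1,1}` on the `C^2` manifold `M`: it is `C^{1,1}` in every chart of the
maximal `C^2` atlas. -/
def MIsC11 (h : M → ℝ) : Prop :=
  ∀ e ∈ IsManifold.maximalAtlas 𝓘(ℝ, EuclideanSpace ℝ (Fin n)) 2 M,
    IsC11On e.target (fun y => h (e.symm y))

end Manifold

/-!
Insertion is a local problem: the condition `f ≤ h ≤ g` is convex in `h`, so local `C^{1,1}` solutions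
are glued by a `C^{1,1}` partition of unity (`exists_mc11_between_of_local`). This needs only
paracompactness, as bumps are built in one chart at a time and normalised by their locally finite sum.

In a chart, `f ≤ g` makes both functions locally bounded, since a semi-convex function is locally
bounded below and a semi-concave one locally bounded above. Boundedness gives uniform bounds on the
supergradients (`SemiconcaveOn.semiconcaveNear`); with those, semi-concavity survives a `C^2` change of
charts (`SemiconcaveNear.comp`), so `f` and `g` may be read in the same chart.

In Euclidean space, put `h = H - C ‖·‖ ^ 2`, where `H` is the convex envelope of `g + C ‖·‖ ^ 2`, that
is, the supremum of the affine functions below it. For large `C` the function `f + C ‖·‖ ^ 2` is convex,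
hence a supremum of affine functions, and so lies below `H`. The second differences of
`g + C ‖·‖ ^ 2` are at most `M ‖v‖ ^ 2`, and the envelope inherits this bound: the mean of the
translates by `± v` of two affine minorants, lowered by `M ‖v‖ ^ 2 / 2`, is again an affine minorant.
A function with subgradients everywhere and with second differences bounded in this way is `C^{1,1}`
(`exists_c11_sup_affine_minorants`). To work on the whole space although `f` and `g` are controlled near
one point only, `g + C ‖·‖ ^ 2` is replaced by a family of quadratic functions, the supporting
paraboloids of `g` at the points of a small ball; increasing `C` keeps those of `f` below them
everywhere (`exists_c11_between_of_semiconcaveNear`).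
-/

open Filter Topology
open scoped NNReal

/-! ### Maps that are Lipschitz or `C^{1,1}` near a point -/

section LipschitzNear

variable {X Y Z : Type*} [PseudoMetricSpace X] [PseudoMetricSpace Y] [PseudoMetricSpace Z]

/-- `f` is Lipschitz on some neighbourhood of `x`. -/
def LipschitzNear (f : X → Y) (x : X) : Prop :=
  ∃ K : ℝ≥0, ∃ V ∈ 𝓝 x, LipschitzOnWith K f V

theorem LipschitzNear.continuousAt {f : X → Y} {x : X} (hf : LipschitzNear f x) :
    ContinuousAt f x := by
  obtain ⟨K, V, hV, h⟩ := hf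
  exact h.continuousOn.continuousAt hV

theorem LipschitzNear.comp {g : Y → Z} {f : X → Y} {x : X} (hg : LipschitzNear g (f x))
    (hf : LipschitzNear f x) : LipschitzNear (fun y => g (f y)) x := by
  have hc := hf.continuousAt
  obtain ⟨K, V, hV, h⟩ := hf
  obtain ⟨K', W, hW, h'⟩ := hg
  refine ⟨K' * K, V ∩ f ⁻¹' W, inter_mem hV (hc hW), ?_⟩
  exact h'.comp (h.mono Set.inter_subset_left) fun y hy => hy.2

theorem LipschitzNear.prodMk {f : X → Y} {g : X → Z} {x : X} (hf : LipschitzNear f x)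
    (hg : LipschitzNear g x) : LipschitzNear (fun y => (f y, g y)) x := by
  obtain ⟨K, V, hV, h⟩ := hf
  obtain ⟨K', W, hW, h'⟩ := hg
  exact ⟨max K K', V ∩ W, inter_mem hV hW,
    (h.mono Set.inter_subset_left).prodMk (h'.mono Set.inter_subset_right)⟩

theorem LipschitzNear.congr {f g : X → Y} {x : X} (hf : LipschitzNear f x) (h : g =ᶠ[𝓝 x] f) :
    LipschitzNear g x := by
  obtain ⟨K, V, hV, hK⟩ := hf
  refine ⟨K, V ∩ {y | g y = f y}, inter_mem hV h, fun y hy z hz => ?_⟩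
  rw [hy.2, hz.2]
  exact hK hy.1 hz.1

end LipschitzNear

section Calculus

variable {E F G : Type*} [NormedAddCommGroup E] [NormedSpace ℝ E]
  [NormedAddCommGroup F] [NormedSpace ℝ F] [NormedAddCommGroup G] [NormedSpace ℝ G]

theorem ContDiffAt.lipschitzNear {f : E → F} {x : E} (hf : ContDiffAt ℝ 1 f x) :
    LipschitzNear f x :=
  hf.exists_lipschitzOnWith

/-- `f` is `C^{1,1}` near `x`: differentiable on a neighbourhood of `x`, with derivative Lipschitz
near `x`. -/
def C11At (f : E → F) (x : E) : Prop :=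
  (∀ᶠ y in 𝓝 x, DifferentiableAt ℝ f y) ∧ LipschitzNear (fderiv ℝ f) x

theorem ContDiffAt.c11At {f : E → F} {x : E} (hf : ContDiffAt ℝ 2 f x) : C11At f x := by
  refine ⟨?_, (hf.fderiv_right (m := 1) (by norm_num)).lipschitzNear⟩
  filter_upwards [hf.eventually (by simp)] with y hy
  exact hy.differentiableAt (by simp)

theorem C11At.lipschitzNear {f : E → F} {x : E} (hf : C11At f x) : LipschitzNear f x := by
  obtain ⟨hd, hl⟩ := hf
  have hb : ∀ᶠ y in 𝓝 x, ‖fderiv ℝ f y‖ < ‖fderiv ℝ f x‖ + 1 :=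
    hl.continuousAt.norm.eventually_lt continuousAt_const (by simp)
  obtain ⟨r, hr, h⟩ := Metric.eventually_nhds_iff_ball.1 (hd.and hb)
  refine ⟨⟨‖fderiv ℝ f x‖ + 1, by positivity⟩, Metric.ball x r, Metric.ball_mem_nhds x hr, ?_⟩
  exact (convex_ball x r).lipschitzOnWith_of_nnnorm_fderiv_le (fun y hy => (h y hy).1)
    fun y hy => (h y hy).2.le

theorem C11At.congr {f g : E → F} {x : E} (hf : C11At f x) (h : g =ᶠ[𝓝 x] f) : C11At g x := by
  refine ⟨?_, hf.2.congr h.fderiv⟩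
  filter_upwards [hf.1, h.eventuallyEq_nhds] with y hy hy'
  exact hy.congr_of_eventuallyEq hy'

theorem C11At.comp {g : F → G} {f : E → F} {x : E} (hg : C11At g (f x)) (hf : C11At f x) :
    C11At (fun y => g (f y)) x := by
  have hfl := hf.lipschitzNear
  have hgd := hfl.continuousAt.eventually hg.1
  refine ⟨?_, ?_⟩
  · filter_upwards [hgd, hf.1] with y h1 h2
    exact h1.comp y h2
  · have hcomp : LipschitzNear (fun p : (F →L[ℝ] G) × (E →L[ℝ] F) => p.1.comp p.2)
        (fderiv ℝ g (f x), fderiv ℝ f x) :=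
      ContDiffAt.lipschitzNear (contDiff_fst.clm_comp contDiff_snd).contDiffAt
    have hD : LipschitzNear (fun y => (fderiv ℝ g (f y)).comp (fderiv ℝ f y)) x :=
      LipschitzNear.comp (f := fun y => (fderiv ℝ g (f y), fderiv ℝ f y)) hcomp
        ((hg.2.comp hfl).prodMk hf.2)
    refine hD.congr ?_
    filter_upwards [hgd, hf.1] with y h1 h2
    exact fderiv_comp y h1 h2

theorem C11At.prodMk {f : E → F} {g : E → G} {x : E} (hf : C11At f x) (hg : C11At g x) :
    C11At (fun y => (f y, g y)) x := by
  refine ⟨?_, ?_⟩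
  · filter_upwards [hf.1, hg.1] with y h1 h2
    exact h1.prodMk h2
  · have hcomp : LipschitzNear (fun p : (E →L[ℝ] F) × (E →L[ℝ] G) => p.1.prod p.2)
        (fderiv ℝ f x, fderiv ℝ g x) :=
      ⟨1, Set.univ, univ_mem,
        (ContinuousLinearMap.prodₗᵢ ℝ).isometry.lipschitz.lipschitzOnWith⟩
    have hD : LipschitzNear (fun y => (fderiv ℝ f y).prod (fderiv ℝ g y)) x :=
      LipschitzNear.comp (f := fun y => (fderiv ℝ f y, fderiv ℝ g y)) hcomp (hf.2.prodMk hg.2)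
    refine hD.congr ?_
    filter_upwards [hf.1, hg.1] with y h1 h2
    exact h1.fderiv_prodMk h2

theorem C11At.add {f g : E → ℝ} {x : E} (hf : C11At f x) (hg : C11At g x) :
    C11At (fun y => f y + g y) x :=
  C11At.comp (g := fun p : ℝ × ℝ => p.1 + p.2) (f := fun y => (f y, g y))
    (ContDiffAt.c11At (by fun_prop)) (hf.prodMk hg)

theorem C11At.mul {f g : E → ℝ} {x : E} (hf : C11At f x) (hg : C11At g x) :
    C11At (fun y => f y * g y) x :=
  C11At.comp (g := fun p : ℝ × ℝ => p.1 * p.2) (f := fun y => (f y, g y))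
    (ContDiffAt.c11At (by fun_prop)) (hf.prodMk hg)

theorem C11At.div {f g : E → ℝ} {x : E} (hf : C11At f x) (hg : C11At g x) (h0 : g x ≠ 0) :
    C11At (fun y => f y / g y) x :=
  C11At.comp (g := fun p : ℝ × ℝ => p.1 / p.2) (f := fun y => (f y, g y))
    (ContDiffAt.c11At (contDiffAt_fst.div contDiffAt_snd h0)) (hf.prodMk hg)

theorem C11At.sum {ι : Type*} {f : ι → E → ℝ} {x : E} (s : Finset ι)
    (hf : ∀ i ∈ s, C11At (f i) x) : C11At (fun y => ∑ i ∈ s, f i y) x := by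
  classical
  induction s using Finset.induction_on with
  | empty => simpa using ContDiffAt.c11At (contDiffAt_const (c := (0 : ℝ)))
  | insert a s ha ih =>
    simp only [Finset.sum_insert ha]
    exact (hf a (by simp)).add (ih fun i hi => hf i (by simp [hi]))

theorem isC11On_of_forall_c11At {O : Set E} (hO : IsOpen O) {f : E → ℝ}
    (h : ∀ x ∈ O, C11At f x) : IsC11On O f := by
  refine ⟨fun x hx => (h x hx).1.self_of_nhds, fun x hx => ?_⟩
  obtain ⟨K, V, hV, hK⟩ := (h x hx).2
  refine ⟨interior V ∩ O, isOpen_interior.inter hO, ⟨mem_interior_iff_mem_nhds.2 hV, hx⟩,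
    Set.inter_subset_right, K, fun y hy z hz => ?_⟩
  exact hK.norm_sub_le (interior_subset hy.1) (interior_subset hz.1)

end Calculus

/-! ### Suprema of affine minorants -/

section AffineMinorants

variable {E : Type*} [NormedAddCommGroup E] [NormedSpace ℝ E]

/-- A function with a subgradient `P x` at each point `x` (hence convex) and with second differences
at most `M ‖v‖ ^ 2` is `C^{1,1}`, with derivative `P`. -/
theorem c11At_of_subgradient_of_second_difference_le {H : E → ℝ} {P : E → E →L[ℝ] ℝ} {M : ℝ}
    (hM : 0 ≤ M) (hsub : ∀ x v, H x + P x v ≤ H (x + v))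
    (hdiff : ∀ x v, H (x + v) + H (x - v) - 2 * H x ≤ M * ‖v‖ ^ 2) (x : E) : C11At H x := by
  have hup : ∀ x v, H (x + v) ≤ H x + P x v + M * ‖v‖ ^ 2 := fun x v => by
    have h1 := hsub x (-v)
    have h2 := hdiff x v
    rw [map_neg, ← sub_eq_add_neg, ← sub_eq_add_neg] at h1
    linarith
  have hder : ∀ x, HasFDerivAt H (P x) x := fun x => by
    rw [hasFDerivAt_iff_isLittleO_nhds_zero]
    refine Asymptotics.IsBigO.trans_isLittleO (g := fun v : E => ‖v‖ ^ 2) ?_ ?_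
    · refine Asymptotics.IsBigO.of_bound M (Eventually.of_forall fun v => ?_)
      have h1 := hsub x v
      have h2 := hup x v
      rw [Real.norm_of_nonneg (by linarith), Real.norm_of_nonneg (by positivity)]
      linarith
    · exact Asymptotics.isLittleO_norm_pow_id one_lt_two
  have hfd : fderiv ℝ H = P := funext fun x => (hder x).fderiv
  refine ⟨Eventually.of_forall fun y => (hder y).differentiableAt,
    ⟨4 * M, by positivity⟩, Set.univ, univ_mem, ?_⟩
  rw [hfd]
  refine LipschitzOnWith.of_dist_le_mul fun z _ y _ => ?_
  rw [dist_comm (P z), dist_comm z y, dist_eq_norm, dist_eq_norm]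
  change ‖P y - P z‖ ≤ 4 * M * ‖y - z‖
  -- comparing the lower bound based at `y` with the upper bound based at `z`, at the point `y + w`
  have key : ∀ w, ‖w‖ ≤ ‖y - z‖ → (P y - P z) w ≤ 4 * M * ‖y - z‖ ^ 2 := fun w hw => by
    have h1 := hsub y w
    have h2 := hsub z (y - z)
    have h3 := hup z (y - z + w)
    rw [show z + (y - z + w) = y + w by abel, map_add] at h3
    rw [show z + (y - z) = y by abel] at h2
    have h4 : ‖y - z + w‖ ≤ 2 * ‖y - z‖ := by linarith [norm_add_le (y - z) w]
    have h5 : M * ‖y - z + w‖ ^ 2 ≤ M * (2 * ‖y - z‖) ^ 2 := by gcongr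
    simp only [sub_apply]
    linarith
  rcases (norm_nonneg (y - z)).eq_or_lt with h0 | h0
  · rw [show y = z from sub_eq_zero.1 (norm_eq_zero.1 h0.symm)]
    simp
  · have := ContinuousLinearMap.opNorm_bound_of_ball_bound h0 (4 * M * ‖y - z‖ ^ 2) (P y - P z)
      fun w hw => by
        rw [mem_closedBall_zero_iff] at hw
        rw [Real.norm_eq_abs, abs_le]
        have h1 := key (-w) (by rwa [norm_neg])
        rw [map_neg] at h1
        exact ⟨by linarith, key w hw⟩
    refine this.trans_eq ?_
    field_simp

variable [FiniteDimensional ℝ E]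

/-- Among the affine functions `y ↦ t + p (y - x)` lying below every member of the family `G`, one
has the largest value `t` at `x`. -/
theorem exists_max_affine_minorant {ι : Type*} (i₀ : ι) {G : ι → E → ℝ}
    (hG : ∀ i, Continuous (G i)) (x : E) (hne : ∃ t : ℝ, ∃ p : E →L[ℝ] ℝ,
      ∀ i y, t + p (y - x) ≤ G i y) :
    ∃ t : ℝ, ∃ p : E →L[ℝ] ℝ, (∀ i y, t + p (y - x) ≤ G i y) ∧
      ∀ (t' : ℝ) (p' : E →L[ℝ] ℝ), (∀ i y, t' + p' (y - x) ≤ G i y) → t' ≤ t := by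
  obtain ⟨t₀, p₀, h₀⟩ := hne
  have : ProperSpace E := FiniteDimensional.proper ℝ E
  have : ProperSpace (E →L[ℝ] ℝ) := FiniteDimensional.proper ℝ _
  let S : Set (ℝ × (E →L[ℝ] ℝ)) := {a | t₀ ≤ a.1 ∧ ∀ i y, a.1 + a.2 (y - x) ≤ G i y}
  have hcl : IsClosed S := by
    have h1 : ∀ (i : ι) (y : E), IsClosed {a : ℝ × (E →L[ℝ] ℝ) | a.1 + a.2 (y - x) ≤ G i y} :=
      fun i y => isClosed_le (by fun_prop) continuous_const
    have h2 : S = {a | t₀ ≤ a.1} ∩ ⋂ i, ⋂ y, {a | a.1 + a.2 (y - x) ≤ G i y} := by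
      ext a
      simp [S]
    rw [h2]
    exact (isClosed_le continuous_const continuous_fst).inter
      (isClosed_iInter fun i => isClosed_iInter fun y => h1 i y)
  obtain ⟨B, hB⟩ := (isCompact_closedBall x 1).exists_bound_of_continuousOn (hG i₀).continuousOn
  have hsub : S ⊆ Set.Icc t₀ (G i₀ x) ×ˢ Metric.closedBall 0 (B - t₀) := by
    rintro ⟨t, p⟩ ⟨h1, h2⟩
    have hp : ∀ v, ‖v‖ ≤ 1 → p v ≤ B - t₀ := fun v hv => by
      have h3 := h2 i₀ (x + v)
      have h4 := (Real.le_norm_self _).trans (hB (x + v) (by simpa using hv))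
      simp only [add_sub_cancel_left] at h3
      dsimp only at h1 h3
      linarith
    refine ⟨⟨h1, by simpa using h2 i₀ x⟩, mem_closedBall_zero_iff.2 ?_⟩
    have := ContinuousLinearMap.opNorm_bound_of_ball_bound one_pos (B - t₀) p fun v hv => by
      rw [mem_closedBall_zero_iff] at hv
      rw [Real.norm_eq_abs, abs_le]
      have h5 := hp (-v) (by rwa [norm_neg])
      rw [map_neg] at h5
      exact ⟨by linarith, hp v hv⟩
    simpa using this
  have hS : IsCompact S :=
    (isCompact_Icc.prod (isCompact_closedBall _ _)).of_isClosed_subset hcl hsub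
  obtain ⟨a, ha, hmax⟩ := hS.exists_isMaxOn ⟨(t₀, p₀), le_rfl, h₀⟩ continuous_fst.continuousOn
  refine ⟨a.1, a.2, ha.2, fun t' p' h' => ?_⟩
  rcases le_total t₀ t' with h | h
  · exact hmax (a := (t', p')) ⟨h, h'⟩
  · exact h.trans ha.1

/-- The supremum `H` of all affine functions lying below a family of functions with second
differences at most `M ‖v‖ ^ 2` is `C^{1,1}`. -/
theorem exists_c11_sup_affine_minorants {ι : Type*} (i₀ : ι) {G : ι → E → ℝ} {M : ℝ} (hM : 0 ≤ M)
    (hG : ∀ i, Continuous (G i))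
    (hdiff : ∀ i x v, G i (x + v) + G i (x - v) - 2 * G i x ≤ M * ‖v‖ ^ 2)
    (hne : ∃ x t, ∃ p : E →L[ℝ] ℝ, ∀ i y, t + p (y - x) ≤ G i y) :
    ∃ H : E → ℝ, (∀ x, C11At H x) ∧ (∀ i x, H x ≤ G i x) ∧
      ∀ x t (p : E →L[ℝ] ℝ), (∀ i y, t + p (y - x) ≤ G i y) → t ≤ H x := by
  obtain ⟨x₀, t₀, p₀, h₀⟩ := hne
  have hex := fun x => exists_max_affine_minorant i₀ hG x ⟨t₀ + p₀ (x - x₀), p₀, fun i y => by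
    have := h₀ i y
    rw [show y - x₀ = (x - x₀) + (y - x) by abel, map_add] at this
    linarith⟩
  choose H P hmin hmax using hex
  have hsub : ∀ x v, H x + P x v ≤ H (x + v) := fun x v =>
    hmax (x + v) _ (P x) fun i y => by
      have := hmin x i y
      rw [show y - x = v + (y - (x + v)) by abel, map_add] at this
      linarith
  -- the mean of the translates by `±v` of two affine minorants, lowered by `M ‖v‖ ^ 2 / 2`, is again
  -- an affine minorant
  have hsec : ∀ x v, H (x + v) + H (x - v) - 2 * H x ≤ M * ‖v‖ ^ 2 := fun x v => by
    have := hmax x ((H (x + v) + H (x - v) - M * ‖v‖ ^ 2) / 2)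
      ((1 / 2 : ℝ) • (P (x + v) + P (x - v))) fun i y => by
        have h1 := hmin (x + v) i (y + v)
        have h2 := hmin (x - v) i (y - v)
        have h3 := hdiff i y v
        rw [show y + v - (x + v) = y - x by abel] at h1
        rw [show y - v - (x - v) = y - x by abel] at h2
        simp only [smul_apply, add_apply, smul_eq_mul]
        linarith
    linarith
  exact ⟨H, c11At_of_subgradient_of_second_difference_le hM hsub hsec,
    fun i x => by simpa using hmin x i x, hmax⟩

end AffineMinorants

/-! ### Semi-concave functions and insertion near a point of a Euclidean space -/

section Semiconcave

variable {E F : Type*} [NormedAddCommGroup E] [NormedSpace ℝ E]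
  [NormedAddCommGroup F] [NormedSpace ℝ F]

/-- `g` is semi-concave for a linear modulus on a neighbourhood of `x₀`, with continuous and uniformly
bounded supergradients. -/
def SemiconcaveNear (g : E → ℝ) (x₀ : E) : Prop :=
  ∃ C L : ℝ, 0 ≤ C ∧ 0 ≤ L ∧ ∃ V ∈ 𝓝 x₀, ∀ x ∈ V, ∃ l : E →L[ℝ] ℝ, ‖l‖ ≤ L ∧
    ∀ y ∈ V, g y - g x ≤ l (y - x) + C * ‖y - x‖ ^ 2

theorem SemiconcaveNear.congr {f g : E → ℝ} {x₀ : E} (hf : SemiconcaveNear f x₀)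
    (h : g =ᶠ[𝓝 x₀] f) : SemiconcaveNear g x₀ := by
  obtain ⟨C, L, hC, hL, V, hV, H⟩ := hf
  refine ⟨C, L, hC, hL, V ∩ {y | g y = f y}, inter_mem hV h, fun x hx => ?_⟩
  obtain ⟨l, hl, hl'⟩ := H x hx.1
  refine ⟨l, hl, fun y hy => ?_⟩
  rw [hy.2, hx.2]
  exact hl' y hy.1

theorem SemiconcaveNear.comp {g : F → ℝ} {τ : E → F} {x₀ : E} (hg : SemiconcaveNear g (τ x₀))
    (hτ : C11At τ x₀) : SemiconcaveNear (fun y => g (τ y)) x₀ := by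
  obtain ⟨C, L, hC, hL, V, hV, H⟩ := hg
  obtain ⟨J, W, hW, hJ⟩ := hτ.lipschitzNear
  have hcont := hτ.lipschitzNear.continuousAt
  obtain ⟨hd, K, U, hU, hK⟩ := hτ
  have hUc : ContinuousAt (fderiv ℝ τ) x₀ := hK.continuousOn.continuousAt hU
  have hb : ∀ᶠ y in 𝓝 x₀, ‖fderiv ℝ τ y‖ < ‖fderiv ℝ τ x₀‖ + 1 :=
    hUc.norm.eventually_lt continuousAt_const (by simp)
  obtain ⟨r, hr, h⟩ := Metric.eventually_nhds_iff_ball.1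
    ((hd.and hb).and ((hcont.eventually (eventually_mem_set.2 hV)).and
      ((eventually_mem_set.2 hW).and (eventually_mem_set.2 hU))))
  refine ⟨L * K + C * J ^ 2, L * (‖fderiv ℝ τ x₀‖ + 1), by positivity, by positivity,
    Metric.ball x₀ r, Metric.ball_mem_nhds _ hr, fun x hx => ?_⟩
  obtain ⟨⟨-, hbx⟩, hVx, hWx, hUx⟩ := h x hx
  obtain ⟨l, hl, hl'⟩ := H (τ x) hVx
  refine ⟨l.comp (fderiv ℝ τ x), (l.opNorm_comp_le _).trans (by gcongr), fun y hy => ?_⟩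
  obtain ⟨-, hVy, hWy, hUy⟩ := h y hy
  have hseg : segment ℝ x y ⊆ Metric.ball x₀ r := (convex_ball x₀ r).segment_subset hx hy
  have htaylor : ‖τ y - τ x - fderiv ℝ τ x (y - x)‖ ≤ K * ‖y - x‖ * ‖y - x‖ :=
    Convex.norm_image_sub_le_of_norm_fderiv_le' (𝕜 := ℝ) (s := segment ℝ x y)
      (fun z hz => (h z (hseg hz)).1.1)
      (fun z hz => (hK.norm_sub_le (h z (hseg hz)).2.2.2 hUx).trans (by
        gcongr
        exact norm_sub_le_of_mem_segment hz))
      (convex_segment x y) (left_mem_segment ℝ x y) (right_mem_segment ℝ x y)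
  have h1 := hl' (τ y) hVy
  have h2 : l (τ y - τ x - fderiv ℝ τ x (y - x)) ≤ L * (K * ‖y - x‖ * ‖y - x‖) :=
    (Real.le_norm_self _).trans ((l.le_opNorm _).trans (by gcongr))
  have h3 : C * ‖τ y - τ x‖ ^ 2 ≤ C * (J * ‖y - x‖) ^ 2 := by
    gcongr
    exact hJ.norm_sub_le hWy hWx
  rw [map_sub] at h2
  simp only [ContinuousLinearMap.comp_apply]
  nlinarith

variable [FiniteDimensional ℝ E]

/-- A locally bounded function that is semi-concave for a linear modulus has uniformly bounded
supergradients. -/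
theorem SemiconcaveOn.semiconcaveNear {ω : ℝ → ℝ} (hω : IsLinearModulus ω) {V : Set E}
    {g : E → ℝ} {x₀ : E} (hV : V ∈ 𝓝 x₀) (hg : SemiconcaveOn ω V g) {N : ℝ}
    (hN : ∀ᶠ y in 𝓝 x₀, |g y| ≤ N) : SemiconcaveNear g x₀ := by
  obtain ⟨-, k, hk, hωk⟩ := hω
  obtain ⟨C, hC⟩ := hg
  obtain ⟨r, hr, h⟩ := Metric.eventually_nhds_iff_ball.1 (hN.and (eventually_mem_set.2 hV))
  have hN0 : 0 ≤ N := (abs_nonneg _).trans (h x₀ (Metric.mem_ball_self hr)).1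
  refine ⟨|C| * k, (2 * N + |C| * k * (r / 4) ^ 2) / (r / 4), by positivity, by positivity,
    Metric.ball x₀ (r / 2), Metric.ball_mem_nhds _ (by positivity), fun x hx => ?_⟩
  have hsub : Metric.ball x₀ (r / 2) ⊆ Metric.ball x₀ r := Metric.ball_subset_ball (by linarith)
  obtain ⟨l, hl⟩ := hC x (h x (hsub hx)).2
  have hl' : ∀ y ∈ Metric.ball x₀ r, g y - g x ≤ l (y - x) + |C| * k * ‖y - x‖ ^ 2 := fun y hy => by
    have h1 := hl y (h y hy).2
    rw [hωk _ (norm_nonneg _)] at h1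
    have h2 : C * (k * ‖y - x‖ ^ 2) ≤ |C| * (k * ‖y - x‖ ^ 2) := by
      gcongr
      exact le_abs_self C
    linarith
  have hlow : ∀ w, ‖w‖ ≤ r / 4 → -l w ≤ 2 * N + |C| * k * (r / 4) ^ 2 := fun w hw => by
    have hy : x + w ∈ Metric.ball x₀ r := by
      rw [mem_ball_iff_norm] at hx ⊢
      calc ‖x + w - x₀‖ = ‖(x - x₀) + w‖ := by congr 1; abel
        _ ≤ ‖x - x₀‖ + ‖w‖ := norm_add_le _ _
        _ < r := by linarith
    have h1 := hl' _ hy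
    rw [add_sub_cancel_left] at h1
    have h2 := (abs_le.1 (h _ hy).1).1
    have h3 := (abs_le.1 (h x (hsub hx)).1).2
    have h4 : |C| * k * ‖w‖ ^ 2 ≤ |C| * k * (r / 4) ^ 2 := by gcongr
    linarith
  refine ⟨LinearMap.toContinuousLinearMap l, ?_, fun y hy => hl' y (hsub hy)⟩
  refine ContinuousLinearMap.opNorm_bound_of_ball_bound (by positivity) _ _ fun w hw => ?_
  rw [mem_closedBall_zero_iff] at hw
  rw [Real.norm_eq_abs, abs_le]
  have h1 := hlow w hw
  have h2 := hlow (-w) (by rwa [norm_neg])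
  rw [map_neg] at h2
  simp only [LinearMap.coe_toContinuousLinearMap']
  exact ⟨by linarith, by linarith⟩

theorem SemiconcaveOn.eventually_le {ω : ℝ → ℝ} (hω : IsLinearModulus ω) {V : Set E}
    {g : E → ℝ} {x₀ : E} (hV : V ∈ 𝓝 x₀) (hg : SemiconcaveOn ω V g) :
    ∀ᶠ y in 𝓝 x₀, g y ≤ g x₀ + 1 := by
  obtain ⟨-, k, hk, hωk⟩ := hω
  obtain ⟨C, hC⟩ := hg
  obtain ⟨l, hl⟩ := hC x₀ (mem_of_mem_nhds hV)
  have hc : Continuous fun y => l (y - x₀) + C * ‖y - x₀‖ * (k * ‖y - x₀‖) := by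
    have := l.continuous_of_finiteDimensional
    fun_prop
  have h1 : ∀ᶠ y in 𝓝 x₀, l (y - x₀) + C * ‖y - x₀‖ * (k * ‖y - x₀‖) < 1 :=
    hc.continuousAt.eventually_lt continuousAt_const (by simp)
  filter_upwards [h1, hV] with y hy hyV
  have h2 := hl y hyV
  rw [hωk _ (norm_nonneg _)] at h2
  linarith

end Semiconcave

section LocalInsertion

variable {E : Type*} [NormedAddCommGroup E] [InnerProductSpace ℝ E] [FiniteDimensional ℝ E]

/-- The inserted function is the supremum of the affine functions below all supporting paraboloids of
`g` at the points of a small ball, shifted by a large multiple of `‖·‖ ^ 2`, minus that multiple. -/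
theorem exists_c11_between_of_semiconcaveNear {f g : E → ℝ} {x₀ : E}
    (hf : SemiconcaveNear (fun y => -f y) x₀) (hg : SemiconcaveNear g x₀)
    (hfg : ∀ᶠ y in 𝓝 x₀, f y ≤ g y) :
    ∃ h : E → ℝ, (∀ x, C11At h x) ∧ ∀ᶠ y in 𝓝 x₀, f y ≤ h y ∧ h y ≤ g y := by
  obtain ⟨C₁, L₁, hC₁, hL₁, V₁, hV₁, H₁⟩ := hf
  obtain ⟨C₂, L₂, hC₂, hL₂, V₂, hV₂, H₂⟩ := hg
  obtain ⟨r, hr, h⟩ := Metric.eventually_nhds_iff_ball.1 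
    (hfg.and (eventually_mem_set.2 (inter_mem hV₁ hV₂)))
  set C := max C₁ C₂ with hCdef
  set L := max L₁ L₂ with hLdef
  have hC : 0 ≤ C := hC₁.trans (le_max_left _ _)
  have hL : 0 ≤ L := hL₁.trans (le_max_left _ _)
  set D : Set E := Metric.ball x₀ (r / 2) with hD
  have hsub : D ⊆ Metric.ball x₀ r := Metric.ball_subset_ball (by linarith)
  -- sub- and supergradients, with common constants
  have hsubg : ∀ z : D, ∃ m : E →L[ℝ] ℝ, ‖m‖ ≤ L ∧ ∀ y ∈ Metric.ball x₀ r,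
      f z + m (y - z) - C * ‖y - z‖ ^ 2 ≤ f y := fun z => by
    obtain ⟨l, hl, hl'⟩ := H₁ z (h z (hsub z.2)).2.1
    refine ⟨-l, by rw [norm_neg]; exact hl.trans (le_max_left _ _), fun y hy => ?_⟩
    have h1 := hl' y (h y hy).2.1
    have h2 : C₁ * ‖y - z‖ ^ 2 ≤ C * ‖y - z‖ ^ 2 := by
      gcongr
      exact le_max_left _ _
    rw [neg_apply]
    linarith
  have hsupg : ∀ x : D, ∃ l : E →L[ℝ] ℝ, ‖l‖ ≤ L ∧ ∀ y ∈ Metric.ball x₀ r,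
      g y ≤ g x + l (y - x) + C * ‖y - x‖ ^ 2 := fun x => by
    obtain ⟨l, hl, hl'⟩ := H₂ x (h x (hsub x.2)).2.2
    refine ⟨l, hl.trans (le_max_right _ _), fun y hy => ?_⟩
    have h1 := hl' y (h y hy).2.2
    have h2 : C₂ * ‖y - x‖ ^ 2 ≤ C * ‖y - x‖ ^ 2 := by
      gcongr
      exact le_max_right _ _
    linarith
  choose m hm hm' using hsubg
  choose l hl hl' using hsupg
  set A := L * r + C * r ^ 2 with hA
  have hA0 : 0 ≤ A := by positivity
  -- `C'` is so large that `C' t ^ 2 ≥ A / 2 + L t` for all `t ≥ r / 2`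
  set C' := C + 2 * L / r + 2 * A / r ^ 2 with hC'
  have hCC' : C ≤ C' := by
    have : 0 ≤ 2 * L / r := by positivity
    have : 0 ≤ 2 * A / r ^ 2 := by positivity
    linarith
  have hfar : ∀ t, r / 2 ≤ t → A / 2 + L * t ≤ C' * t ^ 2 := fun t ht => by
    have ht0 : 0 ≤ t := by linarith
    have h1 : L * t ≤ 2 * L / r * t ^ 2 := by
      rw [div_mul_eq_mul_div, le_div_iff₀ hr]
      nlinarith [mul_nonneg hL ht0]
    have h2 : A / 2 ≤ 2 * A / r ^ 2 * t ^ 2 := by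
      rw [div_mul_eq_mul_div, le_div_iff₀ (by positivity)]
      have : (r / 2) ^ 2 ≤ t ^ 2 := by gcongr
      nlinarith
    have h3 : 0 ≤ C * t ^ 2 := by positivity
    rw [hC']
    linarith
  -- the supporting paraboloids of `f` stay below those of `g` on the whole space
  have hpar : ∀ (x z : D) (y : E), f z + m z (y - z) - C' * ‖y - z‖ ^ 2 ≤
      g x + l x (y - x) + C' * ‖y - x‖ ^ 2 := fun x z y => by
    by_cases hy : y ∈ Metric.ball x₀ r
    · have h1 := hm' z y hy
      have h2 := hl' x y hy
      have h3 := (h y hy).1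
      have h4 : C * ‖y - z‖ ^ 2 ≤ C' * ‖y - z‖ ^ 2 := by gcongr
      have h5 : C * ‖y - x‖ ^ 2 ≤ C' * ‖y - x‖ ^ 2 := by gcongr
      linarith
    · have hdist : ∀ w : D, r / 2 ≤ ‖y - w‖ := fun w => by
        have h1 : dist (w : E) x₀ < r / 2 := w.2
        rw [Metric.mem_ball, not_lt] at hy
        have := dist_triangle y w x₀
        rw [← dist_eq_norm]
        linarith
      have hop : ∀ (p : E →L[ℝ] ℝ) (v : E), ‖p‖ ≤ L → |p v| ≤ L * ‖v‖ := fun p v hp =>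
        (p.le_opNorm v).trans (by gcongr)
      have hxz : ‖(z : E) - x‖ ≤ r := by
        have h1 : dist (x : E) x₀ < r / 2 := x.2
        have h2 : dist (z : E) x₀ < r / 2 := z.2
        have := dist_triangle_right (z : E) x x₀
        rw [← dist_eq_norm]
        linarith
      have hosc : f z - g x ≤ A := by
        have h1 := hl' x z (hsub z.2)
        have h2 := (h z (hsub z.2)).1
        have h3 := (abs_le.1 (hop (l x) (z - x) (hl x))).2
        have h4 : L * ‖(z : E) - x‖ ≤ L * r := by gcongr
        have h5 : C * ‖(z : E) - x‖ ^ 2 ≤ C * r ^ 2 := by gcongr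
        linarith
      have h1 := hfar _ (hdist z)
      have h2 := hfar _ (hdist x)
      have h3 := (abs_le.1 (hop (m z) (y - z) (hm z))).2
      have h4 := (abs_le.1 (hop (l x) (y - x) (hl x))).1
      linarith
  let G : D → E → ℝ := fun x y => g x + l x (y - x) + C' * ‖y - x‖ ^ 2 + C' * ‖y‖ ^ 2
  have hGc : ∀ i, Continuous (G i) := fun i => by fun_prop
  have hC'0 : 0 ≤ C' := hC.trans hCC'
  have hx₀ : x₀ ∈ D := Metric.mem_ball_self (by positivity)
  have hGdiff : ∀ i x v, G i (x + v) + G i (x - v) - 2 * G i x ≤ 4 * C' * ‖v‖ ^ 2 := fun i x v => by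
    have h1 := parallelogram_law_with_norm ℝ x v
    have h2 := parallelogram_law_with_norm ℝ (x - i) v
    dsimp only [G]
    rw [show x + v - i = (x - i) + v by abel, show x - v - i = (x - i) - v by abel, map_add,
      map_sub (l i) (x - i) v]
    apply le_of_eq
    linear_combination C' * h1 + C' * h2
  have hmin : ∀ (z i : D) (y : E), (f z + C' * ‖(z : E)‖ ^ 2) +
      (m z + (2 * C') • innerSL ℝ (z : E)) (y - z) ≤ G i y := fun z i y => by
    have h1 := hpar i z y
    have h2 : ‖y‖ ^ 2 = ‖(z : E)‖ ^ 2 + 2 * inner ℝ (z : E) (y - z) + ‖y - z‖ ^ 2 := by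
      rw [← norm_add_sq_real]
      congr 2
      abel
    simp only [G, add_apply, smul_apply, innerSL_apply_apply,
      smul_eq_mul]
    rw [h2]
    linarith
  obtain ⟨H, hH, hHG, hHmin⟩ := exists_c11_sup_affine_minorants (⟨x₀, hx₀⟩ : D)
    (by positivity) hGc hGdiff ⟨x₀, _, _, hmin ⟨x₀, hx₀⟩⟩
  refine ⟨fun y => H y + -C' * ‖y‖ ^ 2, fun x => (hH x).add (ContDiffAt.c11At ?_), ?_⟩
  · exact contDiffAt_const.mul (contDiff_norm_sq ℝ).contDiffAt
  · filter_upwards [Metric.ball_mem_nhds x₀ (half_pos hr)] with y hy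
    have h1 := hHG ⟨y, hy⟩ y
    have h2 := hHmin y _ _ (hmin ⟨y, hy⟩)
    simp only [G, sub_self, map_zero, norm_zero] at h1
    dsimp only at h2
    exact ⟨by linarith, by linarith⟩

end LocalInsertion

/-! ### Functions of class `C^{1,1}` on a manifold, and gluing -/

section ManifoldC11

theorem eventually_chart_symm {E M : Type*} [TopologicalSpace E] [TopologicalSpace M]
    {e : OpenPartialHomeomorph M E} {x : M} (hx : x ∈ e.source) {p : M → Prop}
    (hp : ∀ᶠ y in 𝓝 x, p y) : ∀ᶠ y in 𝓝 (e x), p (e.symm y) := by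
  have h := e.continuousAt_symm (e.map_source hx)
  rw [ContinuousAt, e.left_inv hx] at h
  exact h.eventually hp

theorem eventuallyEq_comp_chart_transition {E M : Type*} [TopologicalSpace E]
    [TopologicalSpace M] {e e' : OpenPartialHomeomorph M E} {x : M}
    (hx : x ∈ e.source) (hx' : x ∈ e'.source) (u : M → ℝ) :
    (fun y => u (e.symm y)) =ᶠ[𝓝 (e x)] fun y => u (e'.symm (e' (e.symm y))) := by
  filter_upwards [eventually_chart_symm hx (e'.open_source.mem_nhds hx')] with y hy
  rw [e'.left_inv hy]

variable (E : Type*) [NormedAddCommGroup E] [NormedSpace ℝ E]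
  {M : Type*} [TopologicalSpace M] [ChartedSpace E M]

/-- `u : M → ℝ` is `C^{1,1}` near `x` when read in some chart of the maximal `C^2` atlas around `x`;
by `MC11At.c11At` every such chart then does. -/
def MC11At (u : M → ℝ) (x : M) : Prop :=
  ∃ e ∈ IsManifold.maximalAtlas 𝓘(ℝ, E) 2 M, x ∈ e.source ∧
    C11At (fun y => u (e.symm y)) (e x)

variable {E}

theorem contDiffAt_chart_transition {e e' : OpenPartialHomeomorph M E} {x : M}
    (he : e ∈ IsManifold.maximalAtlas 𝓘(ℝ, E) 2 M) (hx : x ∈ e.source)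
    (he' : e' ∈ IsManifold.maximalAtlas 𝓘(ℝ, E) 2 M) (hx' : x ∈ e'.source) :
    ContDiffAt ℝ 2 (fun y => e' (e.symm y)) (e x) := by
  have h := contMDiffOn_of_mem_contDiffGroupoid
    (StructureGroupoid.compatible_of_mem_maximalAtlas he he')
  rw [contMDiffOn_iff_contDiffOn] at h
  have hmem : e x ∈ (e.symm ≫ₕ e').source := by simp [hx, hx']
  exact h.contDiffAt ((e.symm ≫ₕ e').open_source.mem_nhds hmem)

theorem MC11At.c11At {u : M → ℝ} {x : M} (h : MC11At E u x) {e : OpenPartialHomeomorph M E}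
    (he : e ∈ IsManifold.maximalAtlas 𝓘(ℝ, E) 2 M) (hx : x ∈ e.source) :
    C11At (fun y => u (e.symm y)) (e x) := by
  obtain ⟨e', he', hx', hu⟩ := h
  refine C11At.congr (C11At.comp (g := fun y => u (e'.symm y)) (f := fun y => e' (e.symm y)) ?_
    (contDiffAt_chart_transition he hx he' hx').c11At)
    (eventuallyEq_comp_chart_transition hx hx' u)
  rwa [e.left_inv hx]

theorem MC11At.congr {u v : M → ℝ} {x : M} (h : MC11At E u x) (huv : v =ᶠ[𝓝 x] u) :
    MC11At E v x := by
  obtain ⟨e, he, hx, hu⟩ := h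
  exact ⟨e, he, hx, hu.congr (eventually_chart_symm hx huv)⟩

theorem C11At.mc11At_comp_chart {k : E → ℝ} {x : M} {e : OpenPartialHomeomorph M E}
    (hk : C11At k (e x)) (he : e ∈ IsManifold.maximalAtlas 𝓘(ℝ, E) 2 M) (hx : x ∈ e.source) :
    MC11At E (fun y => k (e y)) x := by
  refine ⟨e, he, hx, hk.congr ?_⟩
  filter_upwards [e.open_target.mem_nhds (e.map_source hx)] with y hy
  rw [e.right_inv hy]

variable [IsManifold 𝓘(ℝ, E) 2 M]

theorem mc11At_iff_chartAt {u : M → ℝ} {x : M} :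
    MC11At E u x ↔ C11At (fun y => u ((chartAt E x).symm y)) (chartAt E x x) :=
  ⟨fun h => h.c11At (IsManifold.chart_mem_maximalAtlas x) (mem_chart_source E x),
    fun h => ⟨_, IsManifold.chart_mem_maximalAtlas x, mem_chart_source E x, h⟩⟩

theorem mc11At_const (c : ℝ) (x : M) : MC11At E (fun _ => c) x :=
  mc11At_iff_chartAt.2 (ContDiffAt.c11At contDiffAt_const)

theorem MC11At.mul {u v : M → ℝ} {x : M} (hu : MC11At E u x) (hv : MC11At E v x) :
    MC11At E (fun y => u y * v y) x :=
  mc11At_iff_chartAt.2 ((mc11At_iff_chartAt.1 hu).mul (mc11At_iff_chartAt.1 hv))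

theorem MC11At.div {u v : M → ℝ} {x : M} (hu : MC11At E u x) (hv : MC11At E v x) (h0 : v x ≠ 0) :
    MC11At E (fun y => u y / v y) x :=
  mc11At_iff_chartAt.2 ((mc11At_iff_chartAt.1 hu).div (mc11At_iff_chartAt.1 hv)
    (by rwa [(chartAt E x).left_inv (mem_chart_source E x)]))

theorem MC11At.sum {ι : Type*} {u : ι → M → ℝ} {x : M} (s : Finset ι)
    (hu : ∀ i ∈ s, MC11At E (u i) x) : MC11At E (fun y => ∑ i ∈ s, u i y) x :=
  mc11At_iff_chartAt.2 (C11At.sum s fun i hi => mc11At_iff_chartAt.1 (hu i hi))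

/-- A bump function in a chart, extended by zero; it is `C^{1,1}` because the closure of its support lies
in the domain of the chart. -/
theorem exists_mc11_support_eq [FiniteDimensional ℝ E] {e : OpenPartialHomeomorph M E}
    (he : e ∈ IsManifold.maximalAtlas 𝓘(ℝ, E) 2 M) {V : Set M} (hV : IsOpen V)
    (hVe : closure V ⊆ e.source) :
    ∃ χ : M → ℝ, (∀ x, MC11At E χ x) ∧ (∀ x, 0 ≤ χ x) ∧ ∀ x, χ x ≠ 0 ↔ x ∈ V := by
  classical
  obtain ⟨b, hbs, hbd, hb0⟩ :=
    (e.isOpen_inter_preimage_symm hV).exists_contDiff_support_eq (n := 2)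
  have hmem : ∀ x ∈ e.source, b (e x) ≠ 0 ↔ x ∈ V := fun x hx => by
    rw [← Function.mem_support, hbs]
    simp [hx]
  have heq : ∀ x ∈ e.source, (if x ∈ V then b (e x) else 0) = b (e x) := fun x hx => by
    split_ifs with h
    · rfl
    · exact (not_not.1 (mt (hmem x hx).1 h)).symm
  refine ⟨fun x => if x ∈ V then b (e x) else 0, fun x => ?_, fun x => ?_, fun x => ?_⟩
  · by_cases hx : x ∈ closure V
    · refine (C11At.mc11At_comp_chart (ContDiff.contDiffAt hbd).c11At he (hVe hx)).congr ?_
      filter_upwards [e.open_source.mem_nhds (hVe hx)] with y hy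
      exact heq y hy
    · refine (mc11At_const 0 x).congr ?_
      filter_upwards [isClosed_closure.isOpen_compl.mem_nhds hx] with y hy
      exact if_neg fun h => hy (subset_closure h)
  · dsimp only
    split_ifs
    · exact (hb0 (Set.mem_range_self _)).1
    · exact le_rfl
  · by_cases hx : x ∈ V
    · simpa [hx] using (hmem x (hVe (subset_closure hx))).2 hx
    · simp [hx]

/-- Since the conditions `f ≤ h` and `h ≤ g` are convex, local solutions of the `C^{1,1}` insertion
problem are glued by a `C^{1,1}` partition of unity. -/
theorem exists_mc11_between_of_local [FiniteDimensional ℝ E] [T2Space M] [ParacompactSpace M]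
    {f g : M → ℝ}
    (hloc : ∀ x : M, ∃ e ∈ IsManifold.maximalAtlas 𝓘(ℝ, E) 2 M, ∃ U ⊆ e.source, IsOpen U ∧ x ∈ U ∧
      ∃ h : M → ℝ, ∀ y ∈ U, MC11At E h y ∧ f y ≤ h y ∧ h y ≤ g y) :
    ∃ h : M → ℝ, (∀ x, MC11At E h x) ∧ ∀ x, f x ≤ h x ∧ h x ≤ g x := by
  choose e he U hUe hU hxU k hk using hloc
  obtain ⟨V, hV, hVuniv, hVfin, hVU⟩ := precise_refinement U hU
    (Set.iUnion_eq_univ_iff.2 fun x => ⟨x, hxU x⟩)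
  obtain ⟨W, hWuniv, hW, hWV⟩ := exists_iUnion_eq_closure_subset hV hVfin.point_finite hVuniv
  choose χ hχ hχ0 hχW using fun i =>
    exists_mc11_support_eq (he i) (hW i) ((hWV i).trans ((hVU i).trans (hUe i)))
  have hclU : ∀ i, closure (W i) ⊆ U i := fun i => (hWV i).trans (hVU i)
  have hprod : ∀ i x, MC11At E (fun y => χ i y * k i y) x := fun i x => by
    by_cases hx : x ∈ closure (W i)
    · exact (hχ i x).mul (hk i x (hclU i hx)).1
    · refine (mc11At_const 0 x).congr ?_
      filter_upwards [isClosed_closure.isOpen_compl.mem_nhds hx] with y hy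
      have h0 : χ i y = 0 := not_not.1 (mt (hχW i y).1 fun h => hy (subset_closure h))
      rw [h0, zero_mul]
  have hfin : ∀ x, ∃ s : Finset M, ∀ᶠ y in 𝓝 x, ∀ a : M → ℝ,
      ∑ᶠ i, χ i y * a i = ∑ i ∈ s, χ i y * a i := fun x => by
    obtain ⟨t, ht, hts⟩ := hVfin x
    refine ⟨hts.toFinset, ?_⟩
    filter_upwards [ht] with y hy a
    refine finsum_eq_sum_of_support_subset _ fun i hi => ?_
    have h1 : y ∈ W i := (hχW i y).1 (left_ne_zero_of_mul hi)
    simpa using ⟨y, hWV i (subset_closure h1), hy⟩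
  have hpos : ∀ (s : Finset M) x, (∀ a : M → ℝ, ∑ᶠ i, χ i x * a i = ∑ i ∈ s, χ i x * a i) →
      0 < ∑ i ∈ s, χ i x := fun s x hs => by
    obtain ⟨i, hi⟩ := Set.iUnion_eq_univ_iff.1 hWuniv x
    refine Finset.sum_pos' (fun j _ => hχ0 j x) ⟨i, ?_, (hχ0 i x).lt_of_ne' ((hχW i x).2 hi)⟩
    classical
    by_contra his
    have h1 := hs (Pi.single i 1)
    rw [Finset.sum_eq_zero, finsum_eq_single _ i] at h1
    · simp only [Pi.single_eq_same, mul_one] at h1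
      exact (hχW i x).2 hi h1
    · intro j hj
      simp [hj]
    · intro j hj
      have : j ≠ i := fun h => his (h ▸ hj)
      simp [this]
  refine ⟨fun y => (∑ᶠ i, χ i y * k i y) / ∑ᶠ i, χ i y * 1, fun x => ?_, fun x => ?_⟩
  · obtain ⟨s, hs⟩ := hfin x
    have h1 := (MC11At.sum s fun i _ => hprod i x).div (MC11At.sum s fun i _ => hχ i x)
      (hpos s x hs.self_of_nhds).ne'
    refine h1.congr ?_
    filter_upwards [hs] with y hy
    rw [hy, hy fun _ => 1]
    simp only [mul_one]
  · obtain ⟨s, hs⟩ := hfin x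
    have hs := hs.self_of_nhds
    have h0 := hpos s x hs
    dsimp only
    rw [hs, hs fun _ => 1]
    simp only [mul_one]
    have hval : ∀ i, χ i x ≠ 0 → f x ≤ k i x ∧ k i x ≤ g x := fun i hi =>
      (hk i x (hclU i (subset_closure ((hχW i x).1 hi)))).2
    rw [le_div_iff₀ h0, div_le_iff₀ h0, Finset.mul_sum, Finset.mul_sum]
    constructor <;> refine Finset.sum_le_sum fun i _ => ?_
    · by_cases hi : χ i x = 0
      · simp [hi]
      · rw [mul_comm]
        exact mul_le_mul_of_nonneg_left (hval i hi).1 (hχ0 i x)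
    · by_cases hi : χ i x = 0
      · simp [hi]
      · rw [mul_comm (g x)]
        exact mul_le_mul_of_nonneg_left (hval i hi).2 (hχ0 i x)

end ManifoldC11

theorem MLocallySemiconcaveLinear.eventually_le {n : ℕ} {M : Type*} [TopologicalSpace M]
    [ChartedSpace (EuclideanSpace ℝ (Fin n)) M] {g : M → ℝ} (hg : MLocallySemiconcaveLinear n g)
    (x : M) : ∀ᶠ y in 𝓝 x, g y ≤ g x + 1 := by
  obtain ⟨ω, hω, H⟩ := hg
  obtain ⟨e, -, hx, he⟩ := H x
  obtain ⟨V, hV, hxV, -, hgV⟩ := he _ (e.map_source hx)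
  have h := hgV.eventually_le hω (hV.mem_nhds hxV)
  filter_upwards [(e.continuousAt hx).eventually h, e.open_source.mem_nhds hx] with y hy hye
  rwa [e.left_inv hye, e.left_inv hx] at hy

/-- On a `C^2` manifold, a locally bounded function which is locally semi-concave for a linear modulus
is so in every chart. -/
theorem MLocallySemiconcaveLinear.semiconcaveNear {n : ℕ} {M : Type*} [TopologicalSpace M]
    [ChartedSpace (EuclideanSpace ℝ (Fin n)) M] {g : M → ℝ} (hg : MLocallySemiconcaveLinear n g)
    {x : M} {N : ℝ} (hN : ∀ᶠ y in 𝓝 x, |g y| ≤ N)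
    {e : OpenPartialHomeomorph M (EuclideanSpace ℝ (Fin n))}
    (he : e ∈ IsManifold.maximalAtlas 𝓘(ℝ, EuclideanSpace ℝ (Fin n)) 2 M) (hx : x ∈ e.source) :
    SemiconcaveNear (fun y => g (e.symm y)) (e x) := by
  obtain ⟨ω, hω, H⟩ := hg
  obtain ⟨e', he', hx', hge'⟩ := H x
  obtain ⟨V, hV, hxV, -, hgV⟩ := hge' _ (e'.map_source hx')
  have h := hgV.semiconcaveNear hω (hV.mem_nhds hxV) (eventually_chart_symm hx' hN)
  refine SemiconcaveNear.congr (SemiconcaveNear.comp (g := fun y => g (e'.symm y))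
    (τ := fun y => e' (e.symm y)) ?_ (contDiffAt_chart_transition he hx he' hx').c11At)
    (eventuallyEq_comp_chart_transition hx hx' g)
  rwa [e.left_inv hx]

theorem theorem3p1 (n : ℕ) (M : Type*) [TopologicalSpace M] [T2Space M] [ParacompactSpace M]
    [ChartedSpace (EuclideanSpace ℝ (Fin n)) M]
    [IsManifold 𝓘(ℝ, EuclideanSpace ℝ (Fin n)) 2 M]
    (f g : M → ℝ) (hf : MLocallySemiconvexLinear n f) (hg : MLocallySemiconcaveLinear n g)
    (hfg : ∀ x, f x ≤ g x) :
    ∃ h : M → ℝ, MIsC11 n h ∧ ∀ x, f x ≤ h x ∧ h x ≤ g x := by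
  have hf' : MLocallySemiconcaveLinear n (fun x => -f x) := hf
  suffices hloc : ∃ h : M → ℝ, (∀ x, MC11At (EuclideanSpace ℝ (Fin n)) h x) ∧
      ∀ x, f x ≤ h x ∧ h x ≤ g x by
    obtain ⟨h, hh, hb⟩ := hloc
    refine ⟨h, fun e he => isC11On_of_forall_c11At e.open_target fun y hy => ?_, hb⟩
    have := (hh (e.symm y)).c11At he (e.map_target hy)
    rwa [e.right_inv hy] at this
  refine exists_mc11_between_of_local fun x => ?_
  have he := IsManifold.chart_mem_maximalAtlas (I := 𝓘(ℝ, EuclideanSpace ℝ (Fin n))) (n := 2) x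
  have hx := mem_chart_source (EuclideanSpace ℝ (Fin n)) x
  set e := chartAt (EuclideanSpace ℝ (Fin n)) x
  -- `f` is locally bounded below and `g` locally bounded above, so `f ≤ g` bounds both
  have hb : ∀ᶠ y in 𝓝 x, |f y| ≤ |f x| + |g x| + 1 ∧ |g y| ≤ |f x| + |g x| + 1 := by
    filter_upwards [hf'.eventually_le x, hg.eventually_le x] with y h1 h2
    have h3 := hfg y
    have := neg_abs_le (f x)
    have := le_abs_self (g x)
    have := abs_nonneg (f x)
    have := abs_nonneg (g x)
    exact ⟨abs_le.2 ⟨by linarith, by linarith⟩, abs_le.2 ⟨by linarith, by linarith⟩⟩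
  have hfn := hf'.semiconcaveNear (hb.mono fun y hy => (abs_neg (f y)).trans_le hy.1) he hx
  have hgn := hg.semiconcaveNear (hb.mono fun y hy => hy.2) he hx
  obtain ⟨k, hk, hkb⟩ := exists_c11_between_of_semiconcaveNear
    (f := fun y => f (e.symm y)) hfn hgn (Eventually.of_forall fun y => hfg _)
  have hev : ∀ᶠ y in 𝓝 x, y ∈ e.source ∧ f y ≤ k (e y) ∧ k (e y) ≤ g y := by
    filter_upwards [(e.continuousAt hx).eventually hkb, e.open_source.mem_nhds hx] with y hy hye
    rw [e.left_inv hye] at hy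
    exact ⟨hye, hy⟩
  obtain ⟨U, hU, hUo, hxU⟩ := eventually_nhds_iff.1 hev
  exact ⟨e, he, U, fun y hy => (hU y hy).1, hUo, hxU, fun y => k (e y), fun y hy =>
    ⟨(hk (e y)).mc11At_comp_chart he (hU y hy).1, (hU y hy).2⟩⟩
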